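/- Let $G$ be a metrizable, compactly generated, totally disconnected locally compact group that is metabelian (i.e. its commutator subgroup $[G,G]$ is abelian); compactly generated means that $G$ is generated as a group by some compact subset. A group $\Gamma$ of topological automorphisms of $G$ is called distal if for every $x\in G\setminus\{e\}$ the identity element $e$ is not in the closure of the orbit $\Gamma x=\{\gamma(x) : \gamma\in\Gamma\}$. Then the following conditions are equivalent: (i) $G$ is distal, i.e. the group $\operatorname{Inn}(G)$ of all inner automorphisms of $G$ is distal; (ii) every $g\in G$ is distal, i.e. for every $g\in G$ the group of automorphisms generated by the inner automorphism $x\mapsto gxg^{-1}$ is distal; (iii) $G$ is a SIN group, i.e. the neighbourhoods of $e$ that are invariant under all inner automorphisms of $G$ form a neighbourhood base at $e$. -/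

import Mathlib

open Topology

/-- The group `Aut(G)` of topological automorphisms of `G`, under composition. -/
instance topAutGroup (G : Type*) [Group G] [TopologicalSpace G] : Group (G ≃ₜ* G) where
  mul f g := g.trans f
  one := ContinuousMulEquiv.refl G
  inv f := f.symm
  mul_assoc _ _ _ := rfl
  one_mul _ := rfl
  mul_one _ := rfl
  inv_mul_cancel f := f.self_trans_symm

/-- The homomorphism `G → Aut(G)` that sends `g` to the inner automorphism `x ↦ g * x * g⁻¹`. -/
def topConj (G : Type*) [Group G] [TopologicalSpace G] [IsTopologicalGroup G] :
    G →* (G ≃ₜ* G) where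
  toFun g :=
    { MulAut.conj g with
      continuous_toFun := by
        change Continuous fun x : G => g * x * g⁻¹
        fun_prop
      continuous_invFun := by
        change Continuous fun x : G => g⁻¹ * x * g
        fun_prop }
  map_one' := by
    ext x
    change 1 * x * 1⁻¹ = x
    group
  map_mul' g h := by
    ext x
    change g * h * x * (g * h)⁻¹ = g * (h * x * h⁻¹) * g⁻¹
    group

/-- The group `Inn(G)` of inner automorphisms. -/
def topInn (G : Type*) [Group G] [TopologicalSpace G] [IsTopologicalGroup G] :
    Subgroup (G ≃ₜ* G) :=
  (topConj G).range

/-- A group `Γ` of automorphisms is distal if, for every `x ≠ 1`, the identity element is not in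
the closure of the orbit `Γ x`. -/
def IsDistalAut {G : Type*} [Group G] [TopologicalSpace G] (Γ : Subgroup (G ≃ₜ* G)) : Prop :=
  ∀ x : G, x ≠ 1 → (1 : G) ∉ closure {y : G | ∃ γ ∈ Γ, γ x = y}

/-- A group `Γ` of automorphisms is equicontinuous (at `1`) if the `Γ`-invariant neighbourhoods
of `1` form a neighbourhood base at `1`. -/
def IsEquicontinuousAut {G : Type*} [Group G] [TopologicalSpace G]
    (Γ : Subgroup (G ≃ₜ* G)) : Prop :=
  ∀ U ∈ 𝓝 (1 : G), ∃ V ∈ 𝓝 (1 : G), V ⊆ U ∧ ∀ γ ∈ Γ, (fun x : G => γ x) '' V = V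

/-- An element `g` is distal if the group generated by `x ↦ g * x * g⁻¹` is distal. -/
def IsDistalElement {G : Type*} [Group G] [TopologicalSpace G] [IsTopologicalGroup G]
    (g : G) : Prop :=
  IsDistalAut (Subgroup.zpowers (topConj G g))

/-- `G` is distal if `Inn(G)` is distal. -/
def IsDistalGroup (G : Type*) [Group G] [TopologicalSpace G] [IsTopologicalGroup G] : Prop :=
  IsDistalAut (topInn G)

/-- `G` is a SIN group if `Inn(G)` is equicontinuous. -/
def IsSINGroup (G : Type*) [Group G] [TopologicalSpace G] [IsTopologicalGroup G] : Prop :=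
  IsEquicontinuousAut (topInn G)

/-- `G` is compactly generated (as a group): some compact subset generates `G` algebraically. -/
def IsCompactlyGeneratedGroup (G : Type*) [Group G] [TopologicalSpace G] : Prop :=
  ∃ K : Set G, IsCompact K ∧ Subgroup.closure K = ⊤

/-- `G` is metabelian: the commutator subgroup `[G, G]` is abelian. -/
def IsMetabelianGroup (G : Type*) [Group G] : Prop :=
  ∀ x ∈ commutator G, ∀ y ∈ commutator G, x * y = y * x

/-!
The implication from (ii) to (iii) rests on two ideas.

A single distal automorphism `τ` of a totally disconnected locally compact group is equicontinuous.
Indeed, distality excludes proximal pairs, so by the Ellis–Numakura idempotent every point of a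
compact set `C` with `τ C ⊆ C` is recurrent, and hence `τ⁻¹ C ⊆ C`. Applied to the points whose
orbit never leaves a compact open set, this yields small `τ`-invariant neighbourhoods of `1`.

Equicontinuity of conjugations on `A = [G, G]` passes from `S` and `T` to `S * T`. Since
`G / [G, G]` is abelian, compact generation gives `G = [G, G] ⟨g₁⟩ ⋯ ⟨gₙ⟩ V` with `V` a compact open
subgroup, so all conjugations together are equicontinuous on `A`. For an open subgroup `V`, the
normal core `B` of `V` is therefore a neighbourhood of `1` relative to `A`. For `x` near `1` the
commutators of `x` with a compact generating set lie in `B`, so `x` is central modulo `B` and every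
conjugate of `x` lies in `x B`.
-/

open Filter Function Set
open scoped Pointwise commutatorElement

section Recurrence

variable {X : Type*} [TopologicalSpace X] {f : X → X}

/-- Two points are forward proximal under `f` if their orbits come arbitrarily close to a common
point along the same times, i.e. the forward orbit of the pair accumulates at the diagonal. -/
def IsForwardProximal (f : X → X) (x y : X) : Prop :=
  ∃ z, (z, z) ∈ closure (range fun n : ℕ => (f^[n] x, f^[n] y))

theorem exists_idempotent_mem_closure_iterate [CompactSpace X] [T2Space X] (hf : Continuous f) :
    ∃ u ∈ closure (range fun n : ℕ => f^[n + 1]), u ∘ u = u := by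
  let _ : Semigroup (X → X) := { mul := (· ∘ ·), mul_assoc := fun _ _ _ => rfl }
  set S : Set (X → X) := closure (range fun n : ℕ => f^[n + 1])
  have continuous_comp_right (v : X → X) : Continuous fun u : X → X => u ∘ v :=
    continuous_pi fun x => continuous_apply (v x)
  have iterate_comp_mem (n : ℕ) : MapsTo (f^[n + 1] ∘ ·) S S := by
    refine MapsTo.closure ?_ (continuous_pi fun x => (hf.iterate _).comp (continuous_apply x))
    rintro _ ⟨m, rfl⟩
    exact ⟨n + 1 + m, iterate_add f (n + 1) (m + 1)⟩
  have comp_mem : ∀ u ∈ S, ∀ v ∈ S, u ∘ v ∈ S := fun u hu v hv =>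
    MapsTo.closure_left (f := (· ∘ v)) (by rintro _ ⟨n, rfl⟩; exact iterate_comp_mem n hv)
      (continuous_comp_right v) isClosed_closure hu
  exact exists_idempotent_in_compact_subsemigroup continuous_comp_right S
    (range_nonempty _).closure isClosed_closure.isCompact comp_mem

theorem mem_closure_range_iterate_succ [CompactSpace X] [T2Space X] (hf : Continuous f)
    (hprox : ∀ x y, IsForwardProximal f x y → x = y) (x : X) :
    x ∈ closure (range fun n : ℕ => f^[n + 1] x) := by
  obtain ⟨u, hu, huu⟩ := exists_idempotent_mem_closure_iterate hf
  have hux : x = u x := by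
    -- `x` and `u x` have the same image `u x = u (u x)` under the limit `u` of iterates.
    refine hprox x (u x) ⟨u x, ?_⟩
    have hpair : (u x, u (u x)) ∈ closure (range fun n : ℕ => (f^[n] x, f^[n] (u x))) :=
      map_mem_closure (f := fun v : X → X => (v x, v (u x))) (by fun_prop) hu
        (by rintro _ ⟨n, rfl⟩; exact ⟨n + 1, rfl⟩)
    rwa [show u (u x) = u x from congrFun huu x] at hpair
  have hmem : u x ∈ closure (range fun n : ℕ => f^[n + 1] x) :=
    map_mem_closure (f := fun v : X → X => v x) (by fun_prop) hu
      (by rintro _ ⟨n, rfl⟩; exact ⟨n, rfl⟩)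
  rwa [← hux] at hmem

end Recurrence

section Automorphisms

variable {G : Type*} [Group G] [TopologicalSpace G] {Γ Δ : Subgroup (G ≃ₜ* G)} {τ : G ≃ₜ* G}

theorem coe_pow_topAut (τ : G ≃ₜ* G) (n : ℕ) : ⇑(τ ^ n) = τ^[n] :=
  hom_coe_pow (fun σ : G ≃ₜ* G => ⇑σ) rfl (fun _ _ => rfl) τ n

theorem isEquicontinuousAut_iff :
    IsEquicontinuousAut Γ ↔ ∀ U ∈ 𝓝 (1 : G), ∀ᶠ x in 𝓝 (1 : G), ∀ γ ∈ Γ, γ x ∈ U := by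
  refine forall₂_congr fun U _ => ⟨?_, fun h => ⟨{x | ∀ γ ∈ Γ, γ x ∈ U}, h, ?_, ?_⟩⟩
  · rintro ⟨V, hV, hVU, hinv⟩
    filter_upwards [hV] with x hx γ hγ
    exact hVU (hinv γ hγ ▸ mem_image_of_mem _ hx)
  · exact fun x hx => hx 1 Γ.one_mem
  · refine fun γ hγ => Subset.antisymm ?_ fun x hx => ?_
    · rintro _ ⟨x, hx, rfl⟩ δ hδ
      exact hx (δ * γ) (Γ.mul_mem hδ hγ)
    · exact ⟨γ⁻¹ x, fun δ hδ => hx (δ * γ⁻¹) (Γ.mul_mem hδ (Γ.inv_mem hγ)),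
        γ.apply_symm_apply x⟩

theorem IsDistalAut.mono (h : IsDistalAut Δ) (hle : Γ ≤ Δ) : IsDistalAut Γ := by
  intro x hx hcl
  refine h x hx (closure_mono ?_ hcl)
  rintro y ⟨γ, hγ, hy⟩
  exact ⟨γ, hle hγ, hy⟩

theorem IsEquicontinuousAut.isDistalAut [T1Space G] (h : IsEquicontinuousAut Γ) :
    IsDistalAut Γ := by
  intro x hx hcl
  have havoid : ∀ᶠ y in 𝓝 (1 : G), ∀ γ ∈ Γ, γ y ≠ x :=
    isEquicontinuousAut_iff.1 h {x}ᶜ (isOpen_compl_singleton.mem_nhds hx.symm)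
  obtain ⟨_, hy, γ, hγ, rfl⟩ := mem_closure_iff_nhds.1 hcl _ havoid
  exact hy γ⁻¹ (Γ.inv_mem hγ) (γ.symm_apply_apply x)

variable [IsTopologicalGroup G]

theorem IsDistalAut.eq_of_isForwardProximal (hΓ : IsDistalAut Γ) (hτ : τ ∈ Γ) {x y : G}
    (h : IsForwardProximal τ x y) : x = y := by
  obtain ⟨z, hz⟩ := h
  by_contra hxy
  refine hΓ (x⁻¹ * y) (mt inv_mul_eq_one.1 hxy) ?_
  rw [← inv_mul_cancel z]
  refine map_mem_closure (f := fun p : G × G => p.1⁻¹ * p.2) (by fun_prop) hz ?_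
  rintro _ ⟨n, rfl⟩
  refine ⟨τ ^ n, Γ.pow_mem hτ n, ?_⟩
  rw [map_mul, map_inv, coe_pow_topAut]

theorem IsDistalAut.mapsTo_inv [T2Space G] (hΓ : IsDistalAut Γ) (hτ : τ ∈ Γ) {C : Set G}
    (hC : IsCompact C) (h : MapsTo τ C C) : MapsTo ⇑τ⁻¹ C C := by
  intro x hx
  have : CompactSpace C := isCompact_iff_compactSpace.1 hC
  have hprox (a b : C) (hab : IsForwardProximal (h.restrict τ C C) a b) : a = b := by
    obtain ⟨z, hz⟩ := hab
    refine Subtype.ext (hΓ.eq_of_isForwardProximal hτ ⟨z, ?_⟩)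
    refine map_mem_closure (f := Prod.map Subtype.val Subtype.val) (by fun_prop) hz ?_
    rintro _ ⟨n, rfl⟩
    exact ⟨n, by simp [h.iterate_restrict]⟩
  have hrec : (⟨x, hx⟩ : C) ∈ closure (range fun n : ℕ => (h.restrict τ C C)^[n + 1] ⟨x, hx⟩) :=
    mem_closure_range_iterate_succ (τ.continuous.restrict h) hprox _
  refine hC.isClosed.closure_eq ▸ map_mem_closure (f := fun y : C => τ⁻¹ (y : G))
    (τ⁻¹.continuous.comp continuous_subtype_val) hrec ?_
  rintro _ ⟨n, rfl⟩
  have hback : τ⁻¹ ((h.restrict τ C C)^[n + 1] ⟨x, hx⟩ : C) = τ^[n] x := by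
    rw [h.coe_iterate_restrict, iterate_succ_apply']
    exact τ.symm_apply_apply _
  exact mem_of_eq_of_mem hback (h.iterate n hx)

/-- The points whose backward orbit up to time `n` stays in `V` form a neighbourhood of `1`. For all
`n` at once they form a compact set which distality makes invariant under `τ`; by compactness some
finite `n` already gives a `τ`-invariant set. -/
theorem IsDistalAut.eventually_pow_mem [T2Space G] (hΓ : IsDistalAut Γ) (hτ : τ ∈ Γ) {V : Set G}
    (hVo : IsOpen V) (hVc : IsCompact V) (hV : 1 ∈ V) :
    ∀ᶠ x in 𝓝 (1 : G), ∀ n : ℕ, (τ ^ n) x ∈ V := by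
  let trap (n : ℕ) : Set G := {x | ∀ k ≤ n, (τ⁻¹ ^ k) x ∈ V}
  have trap_subset (n : ℕ) : trap n ⊆ V := fun x hx => hx 0 n.zero_le
  have trap_antitone ⦃m n : ℕ⦄ (hmn : m ≤ n) : trap n ⊆ trap m := fun x hx k hk =>
    hx k (hk.trans hmn)
  have trap_closed (n : ℕ) : IsClosed (trap n) := by
    simp only [trap, ofPred_forall]
    exact isClosed_iInter fun k => isClosed_iInter fun _ =>
      hVc.isClosed.preimage (τ⁻¹ ^ k).continuous
  have trap_compact (n : ℕ) : IsCompact (trap n) :=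
    hVc.of_isClosed_subset (trap_closed n) (trap_subset n)
  have trap_nhds (n : ℕ) : trap n ∈ 𝓝 (1 : G) :=
    (eventually_all_finite (finite_Iic n)).2 fun k _ =>
      (τ⁻¹ ^ k).continuous.continuousAt (hVo.mem_nhds <| by
        rwa [← map_one (τ⁻¹ ^ k)] at hV)
  have iInter_mapsTo_inv : MapsTo ⇑τ⁻¹ (⋂ n, trap n) (⋂ n, trap n) := fun x hx =>
    mem_iInter.2 fun n k hk => mem_iInter.1 hx (n + 1) (k + 1) (by lia)
  have iInter_mapsTo : MapsTo τ (⋂ n, trap n) (⋂ n, trap n) := by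
    simpa only [inv_inv] using hΓ.mapsTo_inv (Γ.inv_mem hτ)
      ((trap_compact 0).of_isClosed_subset (isClosed_iInter trap_closed) (iInter_subset _ 0))
      iInter_mapsTo_inv
  obtain ⟨n, hn⟩ : ∃ n, trap n ⊆ τ ⁻¹' V :=
    exists_subset_nhds_of_isCompact
      (directed_of_isDirected_le trap_antitone) trap_compact
      fun x hx => (hVo.preimage τ.continuous).mem_nhds
        (trap_subset 0 (mem_iInter.1 (iInter_mapsTo hx) 0))
  have trap_mapsTo : MapsTo τ (trap n) (trap n) := by
    rintro x hx (_ | k) hk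
    · exact hn hx
    · have hcancel : (τ⁻¹ ^ (k + 1)) (τ x) = (τ⁻¹ ^ k) x :=
        congrArg (τ⁻¹ ^ k) (τ.symm_apply_apply x)
      exact hcancel ▸ hx k (by lia)
  filter_upwards [trap_nhds n] with x hx m
  rw [coe_pow_topAut]
  exact trap_subset n (trap_mapsTo.iterate m hx)

end Automorphisms

section TotallyDisconnected

variable {G : Type*} [Group G] [TopologicalSpace G] [IsTopologicalGroup G] [LocallyCompactSpace G]
  [TotallyDisconnectedSpace G]

theorem exists_isCompact_isOpen_subgroup_subset {U : Set G} (hU : U ∈ 𝓝 (1 : G)) :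
    ∃ V : Subgroup G, IsOpen (V : Set G) ∧ IsCompact (V : Set G) ∧ (V : Set G) ⊆ U := by
  obtain ⟨K, hK1, hKU, hK⟩ := local_compact_nhds hU
  obtain ⟨W, hW, h1W, hWK⟩ :=
    (loc_compact_Haus_tot_disc_of_zero_dim (H := G)).mem_nhds_iff.1 hK1
  have hWc : IsCompact W := hK.of_isClosed_subset hW.isClosed hWK
  have hleft : ∀ᶠ g in 𝓝 (1 : G), ∀ w ∈ W, g * w ∈ W :=
    hWc.eventually_forall_of_forall_eventually fun w hw =>
      continuous_mul.continuousAt (hW.isOpen.mem_nhds (by rwa [one_mul]))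
  have hleft_inv : ∀ᶠ g in 𝓝 (1 : G), ∀ w ∈ W, g⁻¹ * w ∈ W :=
    (continuous_inv.tendsto' (1 : G) 1 inv_one).eventually hleft
  let V : Subgroup G := MulAction.stabilizer G W
  have hVo : IsOpen (V : Set G) := by
    refine V.isOpen_of_mem_nhds (g := 1) ?_
    filter_upwards [hleft, hleft_inv] with g hg hg'
    exact (smul_set_subset_iff.2 hg).antisymm fun w hw =>
      mem_smul_set_iff_inv_smul_mem.2 (hg' w hw)
  have hVW : (V : Set G) ⊆ W := fun g hg => by
    have hg' : g • W = W := hg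
    simpa only [smul_eq_mul, mul_one, hg'] using smul_mem_smul_set (a := g) h1W
  exact ⟨V, hVo, hWc.of_isClosed_subset (V.isClosed_of_isOpen hVo) hVW, hVW.trans (hWK.trans hKU)⟩

theorem nonarchimedeanGroup_of_totallyDisconnectedSpace : NonarchimedeanGroup G where
  is_nonarchimedean _ hU :=
    let ⟨V, hVo, _, hVU⟩ := exists_isCompact_isOpen_subgroup_subset hU
    ⟨⟨V, hVo⟩, hVU⟩

theorem IsDistalAut.isEquicontinuousAut_zpowers {τ : G ≃ₜ* G}
    (h : IsDistalAut (Subgroup.zpowers τ)) : IsEquicontinuousAut (Subgroup.zpowers τ) := by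
  refine isEquicontinuousAut_iff.2 fun U hU => ?_
  obtain ⟨V, hVo, hVc, hVU⟩ := exists_isCompact_isOpen_subgroup_subset hU
  have hτ : τ ∈ Subgroup.zpowers τ := Subgroup.mem_zpowers τ
  filter_upwards [h.eventually_pow_mem hτ hVo hVc V.one_mem,
    h.eventually_pow_mem (inv_mem hτ) hVo hVc V.one_mem] with x hpos hneg
  rintro _ ⟨n, rfl⟩
  obtain ⟨k, rfl | rfl⟩ := n.eq_nat_or_neg
  · simpa only [zpow_natCast] using hVU (hpos k)
  · simpa only [zpow_neg, zpow_natCast, inv_pow] using hVU (hneg k)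

end TotallyDisconnected

section Conjugation

variable {G : Type*} [Group G] [TopologicalSpace G]

/-- The conjugations by elements of `S` are equicontinuous at `1` on the subgroup `A`, which
carries the topology induced from `G`. -/
def ConjEquicontinuousOn (S : Set G) (A : Subgroup G) : Prop :=
  ∀ U ∈ 𝓝 (1 : G), ∀ᶠ x in 𝓝[A] (1 : G), ∀ g ∈ S, g * x * g⁻¹ ∈ U

namespace ConjEquicontinuousOn

variable {S T : Set G} {A : Subgroup G}

theorem mul [A.Normal] (hS : ConjEquicontinuousOn S A) (hT : ConjEquicontinuousOn T A) :
    ConjEquicontinuousOn (S * T) A := by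
  intro U hU
  filter_upwards [hT _ (mem_nhdsWithin_iff_eventually.1 (hS U hU)), self_mem_nhdsWithin]
    with x hx hxA
  rintro _ ⟨s, hs, t, ht, rfl⟩
  simpa only [mul_assoc, mul_inv_rev] using
    hx t ht (Subgroup.Normal.conj_mem inferInstance x hxA t) s hs

theorem sup {H K : Subgroup G} [H.Normal] [A.Normal] (hH : ConjEquicontinuousOn (H : Set G) A)
    (hK : ConjEquicontinuousOn (K : Set G) A) :
    ConjEquicontinuousOn ((H ⊔ K : Subgroup G) : Set G) A := by
  rw [Subgroup.normal_mul]
  exact hH.mul hK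

theorem commutator_sup_closure_finset [A.Normal]
    (hA : ConjEquicontinuousOn (commutator G : Set G) A) (F : Finset G)
    (hF : ∀ g ∈ F, ConjEquicontinuousOn (Subgroup.zpowers g : Set G) A) :
    ConjEquicontinuousOn ((commutator G ⊔ Subgroup.closure F : Subgroup G) : Set G) A := by
  classical
  induction F using Finset.induction_on with
  | empty => simpa only [Finset.coe_empty, Subgroup.closure_empty, sup_bot_eq] using hA
  | insert g F _ ih =>
    obtain ⟨hg, hF⟩ := Finset.forall_mem_insert _ _ _ |>.1 hF
    have := Subgroup.Normal.of_commutator_le G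
      (le_sup_left : commutator G ≤ commutator G ⊔ Subgroup.closure (F : Set G))
    rw [Finset.coe_insert, insert_eq, union_comm, Subgroup.closure_union, ← sup_assoc,
      ← Subgroup.zpowers_eq_closure]
    exact (ih hF).sup hg

end ConjEquicontinuousOn

variable [IsTopologicalGroup G]

theorem ConjEquicontinuousOn.of_isCompact {K : Set G} (hK : IsCompact K) (A : Subgroup G) :
    ConjEquicontinuousOn K A := fun U hU =>
  nhdsWithin_le_nhds <| hK.eventually_forall_of_forall_eventually fun g _ =>
    (show Continuous fun z : G × G => z.2 * z.1 * z.2⁻¹ by fun_prop).tendsto' (1, g) 1 (by simp) hU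

theorem isSINGroup_iff :
    IsSINGroup G ↔ ∀ U ∈ 𝓝 (1 : G), ∀ᶠ x in 𝓝 (1 : G), ∀ g : G, g * x * g⁻¹ ∈ U := by
  simp only [IsSINGroup, isEquicontinuousAut_iff, topInn, MonoidHom.mem_range,
    forall_exists_index, forall_apply_eq_imp_iff]
  rfl

theorem isSINGroup_of_isMulCommutative [IsMulCommutative G] : IsSINGroup G :=
  isSINGroup_iff.2 fun U hU => by
    filter_upwards [hU] with x hx g
    rwa [mul_comm' g x, mul_inv_cancel_right]

theorem IsSINGroup.conjEquicontinuousOn {A : Subgroup G} (h : IsSINGroup A) :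
    ConjEquicontinuousOn (A : Set G) A := by
  intro U hU
  have hconj : ∀ᶠ x in 𝓝 (1 : A), ∀ a : A, ((a * x * a⁻¹ : A) : G) ∈ U :=
    isSINGroup_iff.1 h (Subtype.val ⁻¹' U) (continuous_subtype_val.continuousAt hU)
  exact (eventually_nhds_subtype_iff (A : Set G) 1 fun x => ∀ g ∈ A, g * x * g⁻¹ ∈ U).1
    (hconj.mono fun x hx g hg => hx ⟨g, hg⟩)

theorem IsDistalElement.conjEquicontinuousOn [LocallyCompactSpace G] [TotallyDisconnectedSpace G]
    {g : G} (hg : IsDistalElement g) (A : Subgroup G) :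
    ConjEquicontinuousOn (Subgroup.zpowers g : Set G) A := by
  intro U hU
  have hequi := isEquicontinuousAut_iff.1 (IsDistalAut.isEquicontinuousAut_zpowers hg) U hU
  filter_upwards [nhdsWithin_le_nhds hequi] with x hx
  rintro _ ⟨n, rfl⟩
  have hmem := hx (topConj G g ^ n) ⟨n, rfl⟩
  rwa [← map_zpow] at hmem

end Conjugation

section CompactlyGenerated

variable {G : Type*} [Group G] [TopologicalSpace G] [IsTopologicalGroup G]

theorem exists_finset_closure_sup_eq_top (hcg : IsCompactlyGeneratedGroup G) {V : Subgroup G}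
    (hV : IsOpen (V : Set G)) : ∃ F : Finset G, Subgroup.closure F ⊔ V = ⊤ := by
  obtain ⟨K, hK, hKG⟩ := hcg
  obtain ⟨F, -, hF⟩ := hK.elim_nhds_subcover (fun k => (fun x => k⁻¹ * x) ⁻¹' (V : Set G))
    fun k _ => (hV.preimage (by fun_prop)).mem_nhds (by simp)
  refine ⟨F, eq_top_iff.2 (hKG ▸ (Subgroup.closure_le _).2 ?_)⟩
  intro x hx
  obtain ⟨k, hk, hkx⟩ := mem_iUnion₂.1 (hF hx)
  simpa only [mul_inv_cancel_left, SetLike.mem_coe] using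
    Subgroup.mul_mem_sup (Subgroup.subset_closure hk) hkx

theorem ConjEquicontinuousOn.univ_of_commutator [LocallyCompactSpace G]
    [TotallyDisconnectedSpace G] {A : Subgroup G} [A.Normal]
    (hA : ConjEquicontinuousOn (commutator G : Set G) A) (hcg : IsCompactlyGeneratedGroup G)
    (hd : ∀ g : G, IsDistalElement g) : ConjEquicontinuousOn univ A := by
  obtain ⟨V, hVo, hVc, -⟩ := exists_isCompact_isOpen_subgroup_subset (G := G) univ_mem
  obtain ⟨F, hF⟩ := exists_finset_closure_sup_eq_top hcg hVo
  have := Subgroup.Normal.of_commutator_le G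
    (le_sup_left : commutator G ≤ commutator G ⊔ Subgroup.closure (F : Set G))
  have hclosure := hA.commutator_sup_closure_finset F fun g _ => (hd g).conjEquicontinuousOn A
  have hsup := hclosure.sup (.of_isCompact hVc A)
  rwa [sup_assoc, hF, sup_top_eq, Subgroup.coe_top] at hsup

theorem commutatorElement_mem_of_closure_eq_top {H : Type*} [Group H] {K : Set H} {B : Subgroup H}
    [B.Normal] (hK : Subgroup.closure K = ⊤) {x : H} (hx : ∀ k ∈ K, ⁅k, x⁆ ∈ B) (g : H) :
    ⁅g, x⁆ ∈ B := by
  have hiff (k : H) :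
      k ∈ (Subgroup.centralizer {(x : H ⧸ B)}).comap (QuotientGroup.mk' B) ↔ ⁅k, x⁆ ∈ B := by
    rw [Subgroup.mem_comap, Subgroup.mem_centralizer_singleton_iff, ← QuotientGroup.mk'_apply,
      ← commutatorElement_eq_one_iff_mul_comm, ← map_commutatorElement, QuotientGroup.mk'_apply,
      QuotientGroup.eq_one_iff]
  exact (hiff g).1 ((Subgroup.closure_le _).2 (fun k hk => (hiff k).2 (hx k hk))
    (hK ▸ Subgroup.mem_top g))

end CompactlyGenerated

theorem ConjEquicontinuousOn.isSINGroup {G : Type*} [Group G] [TopologicalSpace G]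
    [NonarchimedeanGroup G] (hG : ConjEquicontinuousOn univ (commutator G))
    (hcg : IsCompactlyGeneratedGroup G) : IsSINGroup G := by
  obtain ⟨K, hK, hKG⟩ := hcg
  refine isSINGroup_iff.2 fun U hU => ?_
  obtain ⟨V, hVU⟩ := NonarchimedeanGroup.is_nonarchimedean U hU
  let B : Subgroup G := (V : Subgroup G).normalCore
  have hB : ∀ᶠ y in 𝓝 (1 : G), y ∈ commutator G → y ∈ B :=
    eventually_nhdsWithin_iff.1 ((hG V V.mem_nhds_one).mono fun y hy g => hy g trivial)
  have hKB : ∀ᶠ x in 𝓝 (1 : G), ∀ k ∈ K, ⁅k, x⁆ ∈ B := by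
    refine hK.eventually_forall_of_forall_eventually fun k _ => ?_
    have hcont : Continuous fun z : G × G => ⁅z.2, z.1⁆ := by
      simp only [commutatorElement_def]
      fun_prop
    filter_upwards [(hcont.tendsto' (1, k) 1 (commutatorElement_one_right k)).eventually hB]
      with z hz
    exact hz (Subgroup.commutator_mem_commutator (Subgroup.mem_top _) (Subgroup.mem_top _))
  filter_upwards [hKB, V.mem_nhds_one] with x hx hxV g
  have hgx : ⁅g, x⁆ ∈ V :=
    Subgroup.normalCore_le _ (commutatorElement_mem_of_closure_eq_top hKG hx g)
  have hconj : ⁅g, x⁆ * x = g * x * g⁻¹ := inv_mul_cancel_right _ x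
  exact hVU (hconj ▸ mul_mem hgx hxV)

theorem theorem2p15_general (G : Type*) [Group G] [TopologicalSpace G] [IsTopologicalGroup G]
    [LocallyCompactSpace G] [TotallyDisconnectedSpace G]
    (hcg : IsCompactlyGeneratedGroup G) (hsin : IsSINGroup (commutator G)) :
    List.TFAE [IsDistalGroup G, ∀ g : G, IsDistalElement g, IsSINGroup G] := by
  have : NonarchimedeanGroup G := nonarchimedeanGroup_of_totallyDisconnectedSpace
  tfae_have 1 → 2 := fun h g => h.mono (Subgroup.zpowers_le.2 ⟨g, rfl⟩)
  tfae_have 2 → 3 := fun h =>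
    (hsin.conjEquicontinuousOn.univ_of_commutator hcg h).isSINGroup hcg
  tfae_have 3 → 1 := IsEquicontinuousAut.isDistalAut
  tfae_finish

theorem theorem2p15 (G : Type*) [Group G] [TopologicalSpace G] [IsTopologicalGroup G]
    [TopologicalSpace.MetrizableSpace G] [LocallyCompactSpace G] [TotallyDisconnectedSpace G]
    (hcg : IsCompactlyGeneratedGroup G) (hmet : IsMetabelianGroup G) :
    List.TFAE [IsDistalGroup G, ∀ g : G, IsDistalElement g, IsSINGroup G] :=
  have : IsMulCommutative (commutator G) := ⟨⟨fun x y => Subtype.ext (hmet x x.2 y y.2)⟩⟩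
  theorem2p15_general G hcg isSINGroup_of_isMulCommutative
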